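/- Let $p(m)$ denote the number of partitions of the integer $m\ge 0$ (so $p(0)=1$), let $p(m)=0$ for $m<0$, and let $\omega(k)=(3k^2+k)/2$ for $k\in\mathbb Z$. For integers $m\ge 0$ write $(x)_m=x(x-1)\cdots(x-m+1)$ (so $(x)_0=1$), and for integers $\nu\ge 2$, $n$ and $k$ define $$g_\nu(n,k)=\frac{(2\nu-1)\,\big((2\nu-2)_{\nu-1}\big)^2}{2^{2\nu-2}}\sum_{r=0}^{\nu}(-1)^{\nu+r}\frac{2\nu-2r-1}{(2r)!\,(2\nu-2r)!}\,(6k+1)^{2r}\,\big(24n-(6k+1)^2\big)^{\nu-r}.$$ If $\nu\in\{2,3,4,5,7\}$ and $n$ is a positive integer, then $g_\nu(n,0)\neq 0$, only finitely many $k\in\mathbb Z$ satisfy $p(n-\omega(k))\ne 0$, and $$p(n)=\frac{1}{g_\nu(n,0)}\left(-\frac{4\nu}{B_{2\nu}}\binom{2\nu-2}{\nu-2}\sigma_{2\nu-1}(n)+\sum_{k\in\mathbb Z\setminus\{0\}}(-1)^{k+1}g_\nu(n,k)\,p(n-\omega(k))\right),$$ where $B_m$ is the $m$-th Bernoulli number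 and $\sigma_{2\nu-1}(n)=\sum_{d\mid n}d^{2\nu-1}$. -/

import Mathlib

namespace PentagonalRecurrence

/-- The partition function `p : ℤ → ℕ`: the number of partitions of `m` for `m ≥ 0`
(so `p 0 = 1`), and `0` for `m < 0`. -/
def p (m : ℤ) : ℕ :=
  if 0 ≤ m then Fintype.card (Nat.Partition m.toNat) else 0

/-- The pentagonal number `ω(k) = (3k² + k)/2`, for `k ∈ ℤ`. The division is exact, see
`two_mul_omega`. -/
def omega (k : ℤ) : ℤ := (3 * k ^ 2 + k) / 2

theorem two_mul_omega (k : ℤ) : 2 * omega k = 3 * k ^ 2 + k := by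
  unfold omega
  apply Int.mul_ediv_cancel'
  obtain ⟨c, hc⟩ := Int.even_mul_succ_self k
  exact ⟨k ^ 2 + c, by linear_combination hc⟩

/-- The falling factorial `(x)_m` with an integer index: `x (x - 1) ⋯ (x - m + 1)` for `m ≥ 0`
(hence `1` for `m = 0`), and `1 / (x)_{-m}` for `m ≤ -1`. -/
def fallingFactorial (x : ℚ) : ℤ → ℚ
  | Int.ofNat m => ∏ i ∈ Finset.range m, (x - i)
  | Int.negSucc m => 1 / ∏ i ∈ Finset.range (m + 1), (x - i)

/-- The polynomials
`g_ν(n,k) = (2ν-1) ((2ν-2)_{ν-1})² / 2^{2ν-2} ·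
  ∑_{r=0}^{ν} (-1)^{ν+r} (2ν-2r-1) / ((2r)! (2ν-2r)!) · (6k+1)^{2r} (24n-(6k+1)²)^{ν-r}`. -/
def g (ν : ℕ) (n k : ℤ) : ℚ :=
  (2 * (ν : ℚ) - 1) * fallingFactorial (2 * (ν : ℚ) - 2) ((ν : ℤ) - 1) ^ 2
      / (2 : ℚ) ^ (2 * (ν : ℤ) - 2)
    * ∑ r ∈ Finset.range (ν + 1),
        (-1 : ℚ) ^ (ν + r) * (2 * (ν : ℚ) - 2 * (r : ℚ) - 1)
            / (((2 * r).factorial : ℚ) * ((2 * ν - 2 * r).factorial : ℚ))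
          * (6 * (k : ℚ) + 1) ^ (2 * r)
          * (24 * (n : ℚ) - (6 * (k : ℚ) + 1) ^ 2) ^ (ν - r)

end PentagonalRecurrence

/-! The identity compares coefficients of `q ^ n` in the `ν`-th Rankin–Cohen bracket of `η` and `1 /
η`, of weights `1/2` and `-1/2`. That bracket has weight `2ν` and level one; for `2ν = 4, 6, 8, 10,
14` it must be a multiple of the Eisenstein series.

Modularity of `η` is not used. Without the factors `q ^ (±1/24)`, `η` and `1 / η` are
`pentagonalSeries` and `partitionSeries`, and `24 q d/dq` becomes `twist (±1)`. Their logarithmic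
derivatives are `±E₂`, so each twist is the original series times an iterate `logIter (±E₂)`. As the
two series multiply to `1`, the bracket is a combination of products of these iterates
(`bracket_eq`). Ramanujan's differential equations, proved with the Sturm bound, make it a
polynomial in `E₂, E₄, E₆`; the terms with `E₂` cancel and a constant times `E_{2ν}` remains.

By the pentagonal number theorem, the `n`-th coefficient of the bracket is a sum over `k` of `(-1) ^
k * p (n - omega k)` weighted by `g ν n k` up to a scalar (`coeff_bracket_eq_sum`, `g_eq`). Solving
for the term `k = 0` gives the recurrence. -/

namespace PentagonalRecurrence

open PowerSeries Finset Filter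

/-! ### Euler's product as a formal power series: logarithmic derivative and inverse. -/

section Formal

variable (R : Type*) [CommRing R]

/-- The Euler operator `X d/dX` on formal power series. -/
noncomputable def euler : Derivation R R⟦X⟧ R⟦X⟧ := (X : R⟦X⟧) • PowerSeries.derivative R

variable {R}

@[simp]
theorem coeff_euler (f : R⟦X⟧) (n : ℕ) : coeff n (euler R f) = n * coeff n f := by
  rcases n with _ | n
  · simp [euler]
  · simp [euler, coeff_succ_X_mul, coeff_derivative, mul_comm]

@[simp]
theorem constantCoeff_euler (f : R⟦X⟧) : constantCoeff (euler R f) = 0 := by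
  rw [← coeff_zero_eq_constantCoeff_apply, coeff_euler, Nat.cast_zero, zero_mul]

theorem euler_X_pow (m : ℕ) : euler R (X ^ m) = (m : R⟦X⟧) * X ^ m := by
  ext n
  rw [coeff_euler, ← map_natCast (C (R := R)), coeff_C_mul, coeff_X_pow]
  split_ifs with h <;> simp [h]

variable (R) in
/-- The Lambert series `m X ^ m / (1 - X ^ m)`. -/
noncomputable def lambert (m : ℕ) : R⟦X⟧ := .mk fun n ↦ if n ≠ 0 ∧ m ∣ n then (m : R) else 0

theorem one_sub_X_pow_mul_lambert {m : ℕ} (hm : 0 < m) :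
    (1 - X ^ m) * lambert R m = (m : R⟦X⟧) * X ^ m := by
  ext n
  rw [sub_mul, one_mul, map_sub, coeff_X_pow_mul', ← map_natCast (C (R := R)), coeff_C_mul,
    coeff_X_pow]
  simp only [lambert, coeff_mk]
  rcases lt_trichotomy n m with h | rfl | h
  · have : ¬ (n ≠ 0 ∧ m ∣ n) := fun h' ↦ by
      have := Nat.le_of_dvd (Nat.pos_of_ne_zero h'.1) h'.2
      omega
    simp [this, h.not_ge, h.ne]
  · simp [hm.ne']
  · have h1 : (n ≠ 0 ∧ m ∣ n) ↔ (n - m ≠ 0 ∧ m ∣ n - m) := by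
      rw [Nat.dvd_sub_self_right]
      constructor
      · rintro ⟨_, h2⟩; exact ⟨by omega, Or.inl h2⟩
      · rintro ⟨_, h2⟩; exact ⟨by omega, h2.resolve_right (by omega)⟩
    simp [h1, h.le, h.ne']

/-- Logarithmic derivatives add over a product, and that of `1 - X ^ m` is minus a Lambert series.
The identity is multiplied out to avoid division. -/
theorem euler_prod_one_sub_X_pow (s : Finset ℕ) :
    euler R (∏ i ∈ s, (1 - X ^ (i + 1))) =
      -(∏ i ∈ s, (1 - X ^ (i + 1))) * ∑ i ∈ s, lambert R (i + 1) := by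
  classical
  induction s using Finset.induction_on with
  | empty => simp
  | insert a s ha ih =>
    rw [prod_insert ha, sum_insert ha, Derivation.leibniz, ih, map_sub, euler_X_pow,
      ← one_sub_X_pow_mul_lambert (by omega : 0 < a + 1), Derivation.map_one_eq_zero]
    simp only [smul_eq_mul]
    ring

theorem coeff_sum_lambert {s : Finset ℕ} {n : ℕ} (hs : range n ⊆ s) :
    coeff n (∑ i ∈ s, lambert R (i + 1)) = (ArithmeticFunction.sigma 1 n : R) := by
  rcases Nat.eq_zero_or_pos n with rfl | hn
  · simp [lambert]
  rw [map_sum, ArithmeticFunction.sigma_one_apply, Nat.cast_sum]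
  simp only [lambert, coeff_mk, ne_eq, hn.ne', not_false_eq_true, true_and]
  rw [← Finset.sum_filter]
  refine Finset.sum_bij (fun i _ ↦ i + 1) ?_ ?_ ?_ ?_
  · intro i hi
    exact Nat.mem_divisors.2 ⟨(Finset.mem_filter.1 hi).2, hn.ne'⟩
  · intro i _ j _ h; omega
  · intro d hd
    have hd' := Nat.mem_divisors.1 hd
    have h0 := Nat.pos_of_mem_divisors hd
    have h1 := Nat.le_of_dvd hn hd'.1
    refine ⟨d - 1, Finset.mem_filter.2 ⟨hs (Finset.mem_range.2 (by omega)), ?_⟩, by omega⟩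
    rw [Nat.sub_add_cancel h0]; exact hd'.1
  · intro i _; rfl

variable (R) in
/-- The generating function `∑ σ₁(n) X ^ n`. -/
noncomputable def sigmaSeries : R⟦X⟧ := .mk fun n ↦ (ArithmeticFunction.sigma 1 n : R)

variable (R) in
/-- Logarithmic derivative of Euler's product. -/
theorem euler_pentagonalSeries :
    euler R (pentagonalSeries R) = -pentagonalSeries R * sigmaSeries R := by
  ext n
  -- The infinite product is never differentiated: a finite subproduct is chosen that has the right
  -- coefficients up to degree `n` and already involves every divisor of each `m ≤ n`.
  have h1 : ∀ᶠ s : Finset ℕ in atTop, ∀ m ∈ range (n + 1),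
      (∏ i ∈ s, (1 - X ^ (i + 1) : R⟦X⟧)).coeff m = (pentagonalSeries R).coeff m :=
    (eventually_all_finset _).2 fun m _ ↦ coeff_prod_one_sub_X_pow_eventually_eq R m
  obtain ⟨s, hs, hns⟩ := (h1.and (eventually_ge_atTop (range n))).exists
  have key := congrArg (coeff n) (euler_prod_one_sub_X_pow (R := R) s)
  rw [coeff_euler, hs n (by simp), neg_mul, map_neg, coeff_mul] at key
  rw [coeff_euler, key, neg_mul, map_neg, coeff_mul, neg_inj]
  refine Finset.sum_congr rfl fun x hx ↦ ?_
  have hx' := mem_antidiagonal.1 hx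
  rw [hs _ (by simp; omega), coeff_sum_lambert
    ((Finset.range_mono (by omega : x.2 ≤ n)).trans hns), sigmaSeries, coeff_mk]

variable (R) in
/-- The generating function of the partition function. -/
noncomputable def partitionSeries : R⟦X⟧ := .mk fun n ↦ (Fintype.card n.Partition : R)

-- Both series are infinite products, and factor by factor a geometric series meets its inverse. The
-- discrete topology on `R` serves only to give these products a meaning and a unique value.
variable (R) in
theorem partitionSeries_mul_pentagonalSeries :
    partitionSeries R * pentagonalSeries R = 1 := by
  nontriviality R
  let _ : TopologicalSpace R := ⊥
  have _ : DiscreteTopology R := ⟨rfl⟩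
  open scoped PowerSeries.WithPiTopology in
  have h1 := (Nat.Partition.hasProd_powerSeriesMk_card_restricted R (fun _ ↦ True)).mul
    (WithPiTopology.hasProd_one_sub_X_pow R)
  have h2 : (PowerSeries.mk fun n ↦ (#(Nat.Partition.restricted n (fun _ ↦ True)) : R)) =
      partitionSeries R := by
    ext n
    simp [partitionSeries, Nat.Partition.restricted]
  rw [h2] at h1
  refine h1.unique ?_
  convert! hasProd_one using 1
  ext1 i
  simp only [if_true, pow_mul]
  exact WithPiTopology.tsum_pow_mul_one_sub_of_constantCoeff_eq_zero (by simp)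

end Formal

/-! ### Level one forms as `q`-series, the Serre derivative and `E₂`. -/

section Modular

open PowerSeries UpperHalfPlane ModularForm ModularFormClass MatrixGroups EisensteinSeries
open Derivative SlashInvariantFormClass Filter
open scoped Manifold Topology

local notation "𝕢" => Function.Periodic.qParam

/-- `f` is given on the upper half plane by the power series `a` in `q = exp (2πiτ)`. -/
def HasQExpansion (f : ℍ → ℂ) (a : ℂ⟦X⟧) : Prop :=
  ∀ τ : ℍ, HasSum (fun m ↦ coeff m a • 𝕢 1 τ ^ m) (f τ)

namespace HasQExpansion

variable {f g : ℍ → ℂ} {a b : ℂ⟦X⟧}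

theorem sub (hf : HasQExpansion f a) (hg : HasQExpansion g b) : HasQExpansion (f - g) (a - b) :=
  fun τ ↦ by simpa [sub_mul] using (hf τ).sub (hg τ)

theorem smul (hf : HasQExpansion f a) (c : ℂ) : HasQExpansion (c • f) (c • a) :=
  fun τ ↦ by simpa [mul_assoc] using (hf τ).mul_left c

theorem mul (hf : HasQExpansion f a) (hg : HasQExpansion g b) : HasQExpansion (f * g) (a * b) :=
  fun τ ↦ by
    have h1 := (hf τ).summable.norm
    have h2 := (hg τ).summable.norm
    have h3 := summable_norm_sum_mul_antidiagonal_of_summable_norm h1 h2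
    have h4 := tsum_mul_tsum_eq_tsum_sum_antidiagonal_of_summable_norm h1 h2
    rw [(hf τ).tsum_eq, (hg τ).tsum_eq] at h4
    rw [Pi.mul_apply, h4]
    convert! h3.of_norm.hasSum using 2 with n
    rw [coeff_mul, Finset.sum_smul]
    refine Finset.sum_congr rfl fun x hx ↦ ?_
    rw [← Finset.HasAntidiagonal.mem_antidiagonal.1 hx, pow_add]
    simp only [smul_eq_mul]
    ring

theorem isBoundedAtImInfty (hf : HasQExpansion f a) : IsBoundedAtImInfty f :=
  isBoundedAtImInfty_of_hasSum_qExpansion one_pos hf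

theorem normalizedDeriv (hf : HasQExpansion f a) :
    HasQExpansion (normalizedDerivOfComplex f) (euler ℂ a) := by
  intro τ
  -- On the half-plane `Im w > Im τ / 2` every term is dominated by its value at `τ₀ = i Im τ / 2`,
  -- since `‖q‖` decreases with the imaginary part; this justifies termwise differentiation.
  set y : ℝ := τ.im / 2 with hy
  have hy0 : 0 < y := by have := τ.im_pos; simp only [hy]; linarith
  let τ₀ : ℍ := ⟨y * Complex.I, by simpa using hy0⟩
  let U : Set ℂ := {w | y < w.im}
  have hU : IsOpen U := isOpen_lt continuous_const Complex.continuous_im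
  have hτ : (τ : ℂ) ∈ U := by
    have := τ.im_pos
    simp only [U, Set.mem_ofPred_eq, coe_im, hy]; linarith
  have hd (m : ℕ) (w : ℂ) : HasDerivAt (fun w ↦ coeff m a • 𝕢 1 w ^ m)
      ((2 * Real.pi * Complex.I) * (coeff m (euler ℂ a) • 𝕢 1 w ^ m)) w := by
    have h1 : HasDerivAt (fun w ↦ 𝕢 1 w ^ m)
        (m * 𝕢 1 w ^ (m - 1) * (𝕢 1 w * (2 * Real.pi * Complex.I))) w := by
      refine HasDerivAt.pow ?_ m
      have h0 : HasDerivAt (fun w : ℂ ↦ 2 * Real.pi * Complex.I * w) (2 * Real.pi * Complex.I) w := by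
        simpa using (hasDerivAt_id w).const_mul (2 * Real.pi * Complex.I : ℂ)
      have hq : 𝕢 1 = fun w ↦ Complex.exp (2 * Real.pi * Complex.I * w) := by
        ext w; simp [Function.Periodic.qParam]
      simpa [hq] using h0.cexp
    convert! h1.const_smul (coeff m a) using 1
    rcases m with _ | m
    · simp
    · simp only [coeff_euler, smul_eq_mul, Nat.add_sub_cancel]
      ring
  have hle (m : ℕ) (w : ℂ) (hw : w ∈ U) :
      ‖coeff m a • 𝕢 1 w ^ m‖ ≤ ‖coeff m a • 𝕢 1 τ₀ ^ m‖ := by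
    rw [norm_smul, norm_smul, norm_pow, norm_pow]
    gcongr 2
    rw [Function.Periodic.norm_qParam, Function.Periodic.norm_qParam]
    have : (τ₀ : ℂ).im = y := by simp [τ₀]
    rw [this]
    have hw' : y < w.im := hw
    have := Real.pi_pos
    simp only [div_one]
    apply Real.exp_le_exp.2
    nlinarith
  have key := Complex.hasSum_deriv_of_summable_norm (hf τ₀).summable.norm
    (fun m ↦ fun w _ ↦ (hd m w).differentiableAt.differentiableWithinAt) hU hle hτ
  have heq : (fun w : ℂ ↦ ∑' m, coeff m a • 𝕢 1 w ^ m) =ᶠ[𝓝 (τ : ℂ)] f ∘ ofComplex := by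
    filter_upwards [hU.mem_nhds hτ] with w hw
    have hw0 : 0 < w.im := hy0.trans hw
    simpa [ofComplex_apply_of_im_pos hw0] using (hf ⟨w, hw0⟩).tsum_eq
  rw [heq.deriv_eq] at key
  simp only [fun m ↦ (hd m τ).deriv] at key
  have h2 : (2 * Real.pi * Complex.I : ℂ) ≠ 0 := Complex.two_pi_I_ne_zero
  have key2 := key.mul_left (2 * Real.pi * Complex.I : ℂ)⁻¹
  simp only [inv_mul_cancel_left₀ h2] at key2
  exact key2

end HasQExpansion

/-- A level one modular form, given as a function with its `q`-series. -/
structure IsLevelOne (k : ℕ) (f : ℍ → ℂ) (a : ℂ⟦X⟧) : Prop where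
  hasQExpansion : HasQExpansion f a
  mdiff : MDiff f
  slash : ∀ γ : SL(2, ℤ), f ∣[(k : ℤ)] γ = f

namespace IsLevelOne

variable {k l : ℕ} {f g : ℍ → ℂ} {a b : ℂ⟦X⟧}

theorem sub (hf : IsLevelOne k f a) (hg : IsLevelOne k g b) : IsLevelOne k (f - g) (a - b) where
  hasQExpansion := hf.hasQExpansion.sub hg.hasQExpansion
  mdiff := hf.mdiff.sub hg.mdiff
  slash γ := by rw [sub_eq_add_neg, SlashAction.add_slash, SlashAction.neg_slash, hf.slash, hg.slash]

theorem smul (hf : IsLevelOne k f a) (c : ℂ) : IsLevelOne k (c • f) (c • a) where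
  hasQExpansion := hf.hasQExpansion.smul c
  mdiff := hf.mdiff.const_smul c
  slash γ := by rw [SL_smul_slash, hf.slash]

theorem mul (hf : IsLevelOne k f a) (hg : IsLevelOne l g b) :
    IsLevelOne (k + l) (f * g) (a * b) where
  hasQExpansion := hf.hasQExpansion.mul hg.hasQExpansion
  mdiff := hf.mdiff.mul hg.mdiff
  slash γ := by rw [Nat.cast_add, mul_slash_SL2, hf.slash, hg.slash]

/-- The Sturm bound for `q`-series. -/
theorem eq_zero (hf : IsLevelOne k f a) (h : ((k / 12 : ℕ) : ℕ∞) < a.order) : a = 0 := by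
  let F : ModularForm 𝒮ℒ (k : ℤ) :=
    { toFun := f
      slash_action_eq' := fun _ ⟨γ, hγ⟩ ↦ hγ ▸ hf.slash γ
      holo' := hf.mdiff
      -- Invariance under all of `SL(2, ℤ)` reduces every cusp to `∞`, where the `q`-series gives
      -- boundedness.
      bdd_at_cusps' := fun {c} hc ↦ by
        rw [Subgroup.IsArithmetic.isCusp_iff_isCusp_SL2Z] at hc
        rw [OnePoint.isBoundedAt_iff_forall_SL2Z hc]
        intro γ _
        rw [hf.slash γ]
        exact hf.hasQExpansion.isBoundedAtImInfty }
  have hF : a = qExpansion 1 F := by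
    ext m
    exact ModularFormClass.qExpansion_coeff_unique (f := F) one_pos one_mem_strictPeriods_SL
      hf.hasQExpansion m
  have h0 : F = 0 := sturm_bound_levelOne_nat (by rwa [← hF])
  rw [hF, h0]
  exact qExpansion_zero 1

end IsLevelOne

/-- The `q`-series of the Eisenstein series of weight `k`. -/
noncomputable def eisenstein (k : ℕ) : ℚ⟦X⟧ :=
  .mk fun m ↦ if m = 0 then 1 else -(2 * k / bernoulli k) * (ArithmeticFunction.sigma (k - 1) m : ℚ)

/-- The `q`-series of the Eisenstein series of weight `k`, with complex coefficients. -/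
noncomputable def eisensteinC (k : ℕ) : ℂ⟦X⟧ := (eisenstein k).map (algebraMap ℚ ℂ)

theorem coeff_eisensteinC (k m : ℕ) : coeff m (eisensteinC k) =
    if m = 0 then 1 else -(2 * k / bernoulli k : ℂ) * (ArithmeticFunction.sigma (k - 1) m : ℂ) := by
  simp only [eisensteinC, eisenstein, coeff_map, coeff_mk]
  split_ifs <;> simp

theorem isLevelOne_E {k : ℕ} (hk : 3 ≤ k) (hk2 : Even k) :
    IsLevelOne k (E hk) (eisensteinC k) where
  hasQExpansion τ := by
    have := ModularForm.hasSum_qExpansion (f := E hk) one_pos one_mem_strictPeriods_SL τ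
    simpa [E_qExpansion_coeff hk hk2, coeff_eisensteinC] using this
  mdiff := ModularFormClass.holo (E hk)
  slash γ := slash_action_eq (E hk) _ ⟨γ, rfl⟩

theorem hasQExpansion_E2 : HasQExpansion E2 (eisensteinC 2) := fun τ ↦ by
  have := hasSum_qExpansion_E2 τ
  simp only [coeff_eisensteinC]
  simp only [Function.Periodic.qParam, Complex.ofReal_one, div_one,
    show bernoulli 2 = 1 / 6 by decide +kernel]
  norm_num at this ⊢
  exact this

/-- The Serre derivative of a level one form is a level one form. -/
theorem IsLevelOne.serreDerivative {k : ℕ} {f : ℍ → ℂ} {a : ℂ⟦X⟧} (hf : IsLevelOne k f a) :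
    IsLevelOne (k + 2) (Derivative.serreDerivative k f)
      (euler ℂ a - (k / 12 : ℂ) • (eisensteinC 2 * a)) where
  hasQExpansion := by
    convert hf.hasQExpansion.normalizedDeriv.sub
      ((hasQExpansion_E2.mul hf.hasQExpansion).smul (k / 12 : ℂ)) using 1
    ext z
    simp [div_eq_mul_inv, mul_assoc]
  mdiff := serreDerivative_mdifferentiable _ hf.mdiff
  slash γ := by
    have := serreDerivative_slash_invariant (k := (k : ℤ)) hf.mdiff (hf.slash γ)
    simpa using this

/-- The derivative of `E₂` differs from `E₂² / 12` by a level one form of weight `4`. -/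
theorem isLevelOne_derivE2 :
    IsLevelOne 4 (normalizedDerivOfComplex E2 - (1 / 12 : ℂ) • (E2 * E2))
      (euler ℂ (eisensteinC 2) - (1 / 12 : ℂ) • (eisensteinC 2 * eisensteinC 2)) where
  hasQExpansion := hasQExpansion_E2.normalizedDeriv.sub
    ((hasQExpansion_E2.mul hasQExpansion_E2).smul _)
  mdiff := (normalizedDerivOfComplex_mdifferentiable E2_mdifferentiable).sub
    ((E2_mdifferentiable.mul E2_mdifferentiable).const_smul _)
  slash γ := by
    have hpi : (Real.pi : ℂ) ≠ 0 := Complex.ofReal_ne_zero.2 Real.pi_ne_zero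
    -- With `D` the normalized derivative, `E₂ ∣ γ = E₂ + 12 w` and `D w = -w²`. Hence `D E₂` and
    -- `E₂² / 12` both change by `2 w E₂ + 12 w²` under `γ`, and the difference is invariant.
    set w : ℍ → ℂ := fun z ↦ (2 * Real.pi * Complex.I)⁻¹ * (γ 1 0 / denom γ z) with hw
    have hE : E2 ∣[(2 : ℤ)] γ = E2 + (12 : ℂ) • w := by
      ext z
      simp only [E2_slash_action, D2, riemannZeta_two, hw, Pi.sub_apply, Pi.add_apply,
        Pi.smul_apply, smul_eq_mul]
      have := denom_ne_zero γ z
      have hI := Complex.I_sq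
      field_simp
      linear_combination (-12 : ℂ) * γ 1 0 * hI
    have hdw (z : ℍ) : HasDerivAt (w ∘ ofComplex)
        (-(2 * Real.pi * Complex.I) * (w z * w z)) z := by
      have h1 := (hasDerivAt_denom_zpow (γ : GL (Fin 2) ℝ) (-1) z).const_mul
        ((2 * Real.pi * Complex.I)⁻¹ * (γ 1 0 : ℂ))
      have h2 : w ∘ ofComplex =ᶠ[𝓝 (z : ℂ)] fun x ↦
          ((2 * Real.pi * Complex.I)⁻¹ * (γ 1 0 : ℂ)) * denom (γ : GL (Fin 2) ℝ) x ^ (-1 : ℤ) := by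
        filter_upwards [isOpen_upperHalfPlaneSet.mem_nhds z.im_pos] with x hx
        simp only [hw, Function.comp_apply, ofComplex_apply_of_im_pos hx, zpow_neg_one]
        ring
      refine (h1.congr_of_eventuallyEq h2).congr_deriv ?_
      have := denom_ne_zero γ z
      simp only [hw]
      norm_num
      field_simp
      linear_combination (γ 1 0 : ℂ) ^ 2 * Complex.I_sq
    have hmw : MDiff w := fun z ↦ mdifferentiableAt_iff.2 (hdw z).differentiableAt
    have hDw : normalizedDerivOfComplex w = -(w * w) := by
      ext z
      simp only [normalizedDerivOfComplex, (hdw z).deriv, Pi.neg_apply, Pi.mul_apply]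
      have := Complex.two_pi_I_ne_zero
      field_simp
    have hD := normalizedDerivOfComplex_SL_slash (k := 2) E2_mdifferentiable (γ := γ)
    rw [hE, normalizedDerivOfComplex_add _ _ E2_mdifferentiable (hmw.const_smul _),
      normalizedDerivOfComplex_smul _ _ hmw, hDw] at hD
    have hEE : (E2 * E2) ∣[(4 : ℤ)] γ = (E2 + (12 : ℂ) • w) * (E2 + (12 : ℂ) • w) := by
      rw [← hE]
      exact mul_slash_SL2 2 2 γ E2 E2
    rw [sub_eq_add_neg, SlashAction.add_slash, SlashAction.neg_slash, SL_smul_slash]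
    ext z
    have hDz : normalizedDerivOfComplex E2 z + 12 * -(w z * w z) =
        (normalizedDerivOfComplex E2 ∣[(4 : ℤ)] γ) z - 2 * w z * (E2 z + 12 * w z) := by
      refine (congrFun hD z).trans ?_
      simp only [Pi.sub_apply, Pi.add_apply, Pi.smul_apply, smul_eq_mul, Int.cast_ofNat, hw,
        mul_assoc]
      rfl
    have hEz := congrFun hEE z
    simp only [Pi.add_apply, Pi.smul_apply, Pi.mul_apply, Pi.neg_apply, smul_eq_mul,
      Nat.cast_ofNat] at hEz ⊢
    rw [hEz]
    linear_combination -hDz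

end Modular

/-! ### Ramanujan's differential equations and the Eisenstein series of weights 8, 10, 14. -/

section Ramanujan

open PowerSeries EisensteinSeries

theorem euler_map (a : ℚ⟦X⟧) :
    euler ℂ (a.map (algebraMap ℚ ℂ)) = (euler ℚ a).map (algebraMap ℚ ℂ) := by
  ext n; simp

/-- The Sturm bound for `q`-series with rational coefficients. -/
theorem IsLevelOne.eq_zero_of_coeff {k : ℕ} {f : UpperHalfPlane → ℂ} {a : ℚ⟦X⟧}
    (hf : IsLevelOne k f (a.map (algebraMap ℚ ℂ))) (h : ∀ m ≤ k / 12, coeff m a = 0) : a = 0 := by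
  have h0 := hf.eq_zero <| by
    refine lt_of_lt_of_le (b := ((k / 12 + 1 : ℕ) : ℕ∞)) (by exact_mod_cast Nat.lt_succ_self _)
      (nat_le_order _ _ fun i hi ↦ ?_)
    simp [h i (by omega)]
  exact map_injective _ (algebraMap ℚ ℂ).injective (h0.trans (map_zero _).symm)

theorem constantCoeff_eisenstein (k : ℕ) : constantCoeff (eisenstein k) = 1 := by
  simp [eisenstein, ← coeff_zero_eq_constantCoeff_apply]

theorem coeff_one_eisenstein (k : ℕ) : coeff 1 (eisenstein k) = -(2 * k / bernoulli k) := by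
  simp [eisenstein]

theorem eisenstein_two : eisenstein 2 = 1 - 24 * sigmaSeries ℚ := by
  ext n
  rw [show (24 : ℚ⟦X⟧) = C 24 from (map_ofNat C 24).symm, map_sub, coeff_C_mul, coeff_one]
  simp only [eisenstein, sigmaSeries, coeff_mk, show bernoulli 2 = 1 / 6 by decide +kernel]
  split_ifs with h
  · simp [h]
  · norm_num

/-- Both sides come from forms of weight `4 < 12`, so equality of constant terms suffices. The
factor `24` matches the operator used in `twist`. -/
theorem euler_eisenstein_two :
    24 * euler ℚ (eisenstein 2) = 2 * (eisenstein 2 ^ 2 - eisenstein 4) := by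
  have h := isLevelOne_derivE2.sub
    ((isLevelOne_E (k := 4) (by norm_num) ⟨2, rfl⟩).smul (-1 / 12 : ℂ))
  have h0 := IsLevelOne.eq_zero_of_coeff (k := 4) (a := euler ℚ (eisenstein 2) -
    C (1 / 12) * (eisenstein 2 * eisenstein 2) - C (-1 / 12) * eisenstein 4)
    (by simpa [eisensteinC, euler_map, smul_eq_C_mul] using h)
    (by
      intro m hm
      obtain rfl : m = 0 := by omega
      norm_num [constantCoeff_eisenstein])
  have h1 : (12 : ℚ⟦X⟧) * C (1 / 12) = 1 := by
    rw [show (12 : ℚ⟦X⟧) = C 12 from (map_ofNat C 12).symm, ← map_mul]; norm_num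
  have h2 : (12 : ℚ⟦X⟧) * C (-1 / 12) = -1 := by
    rw [show (12 : ℚ⟦X⟧) = C 12 from (map_ofNat C 12).symm, ← map_mul]; norm_num
  linear_combination 24 * h0 + 2 * eisenstein 2 ^ 2 * h1 + 2 * eisenstein 4 * h2

theorem eisenstein_eight : eisenstein 8 = eisenstein 4 ^ 2 := by
  have h4 := isLevelOne_E (k := 4) (by norm_num) ⟨2, rfl⟩
  have h := (isLevelOne_E (k := 8) (by norm_num) ⟨4, rfl⟩).sub (h4.mul h4)
  refine sub_eq_zero.1 (IsLevelOne.eq_zero_of_coeff (k := 8) (by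
    simpa [eisensteinC, pow_two] using h) fun m hm ↦ ?_)
  obtain rfl : m = 0 := by omega
  norm_num [constantCoeff_eisenstein]

theorem eisenstein_ten : eisenstein 10 = eisenstein 4 * eisenstein 6 := by
  have h4 := isLevelOne_E (k := 4) (by norm_num) ⟨2, rfl⟩
  have h6 := isLevelOne_E (k := 6) (by norm_num) ⟨3, rfl⟩
  have h := (isLevelOne_E (k := 10) (by norm_num) ⟨5, rfl⟩).sub (h4.mul h6)
  refine sub_eq_zero.1 (IsLevelOne.eq_zero_of_coeff (k := 10) (by
    simpa [eisensteinC] using h) fun m hm ↦ ?_)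
  obtain rfl : m = 0 := by omega
  norm_num [constantCoeff_eisenstein]

theorem eisenstein_fourteen : eisenstein 14 = eisenstein 4 ^ 2 * eisenstein 6 := by
  have h4 := isLevelOne_E (k := 4) (by norm_num) ⟨2, rfl⟩
  have h6 := isLevelOne_E (k := 6) (by norm_num) ⟨3, rfl⟩
  have h := (isLevelOne_E (k := 14) (by norm_num) ⟨7, rfl⟩).sub ((h4.mul h4).mul h6)
  refine sub_eq_zero.1 (IsLevelOne.eq_zero_of_coeff (k := 14) (by
    simpa [eisensteinC, pow_two] using h) fun m hm ↦ ?_)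
  -- In weight 14 the Sturm bound is `1`, so the coefficient of `q` must also agree: `-24 = 2 * 240
  -- - 504`.
  have hm' : m = 0 ∨ m = 1 := by omega
  rcases hm' with rfl | rfl
  · norm_num [constantCoeff_eisenstein]
  · simp only [map_sub, pow_two, coeff_one_mul, map_mul, constantCoeff_eisenstein,
      coeff_one_eisenstein, show bernoulli 4 = -1 / 30 by decide +kernel,
      show bernoulli 6 = 1 / 42 by decide +kernel, show bernoulli 14 = 7 / 6 by decide +kernel]
    norm_num

theorem euler_eisenstein_four :
    24 * euler ℚ (eisenstein 4) = 8 * (eisenstein 2 * eisenstein 4 - eisenstein 6) := by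
  have h := (isLevelOne_E (k := 4) (by norm_num) ⟨2, rfl⟩).serreDerivative.sub
    ((isLevelOne_E (k := 6) (by norm_num) ⟨3, rfl⟩).smul (-1 / 3 : ℂ))
  have h0 := IsLevelOne.eq_zero_of_coeff (k := 6) (a := euler ℚ (eisenstein 4) -
    C (4 / 12) * (eisenstein 2 * eisenstein 4) - C (-1 / 3) * eisenstein 6)
    (by simpa [eisensteinC, euler_map, smul_eq_C_mul] using h)
    (by
      intro m hm
      obtain rfl : m = 0 := by omega
      norm_num [constantCoeff_eisenstein])
  have h1 : (3 : ℚ⟦X⟧) * C (4 / 12) = 1 := by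
    rw [show (3 : ℚ⟦X⟧) = C 3 from (map_ofNat C 3).symm, ← map_mul]; norm_num
  have h2 : (3 : ℚ⟦X⟧) * C (-1 / 3) = -1 := by
    rw [show (3 : ℚ⟦X⟧) = C 3 from (map_ofNat C 3).symm, ← map_mul]; norm_num
  linear_combination 24 * h0 + 8 * eisenstein 2 * eisenstein 4 * h1 + 8 * eisenstein 6 * h2

theorem euler_eisenstein_six :
    24 * euler ℚ (eisenstein 6) = 12 * (eisenstein 2 * eisenstein 6 - eisenstein 4 ^ 2) := by
  have h := (isLevelOne_E (k := 6) (by norm_num) ⟨3, rfl⟩).serreDerivative.sub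
    ((isLevelOne_E (k := 8) (by norm_num) ⟨4, rfl⟩).smul (-1 / 2 : ℂ))
  have h0 := IsLevelOne.eq_zero_of_coeff (k := 8) (a := euler ℚ (eisenstein 6) -
    C (6 / 12) * (eisenstein 2 * eisenstein 6) - C (-1 / 2) * eisenstein 8)
    (by simpa [eisensteinC, euler_map, smul_eq_C_mul] using h)
    (by
      intro m hm
      obtain rfl : m = 0 := by omega
      norm_num [constantCoeff_eisenstein])
  have h1 : (2 : ℚ⟦X⟧) * C (6 / 12) = 1 := by
    rw [show (2 : ℚ⟦X⟧) = C 2 from (map_ofNat C 2).symm, ← map_mul]; norm_num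
  have h2 : (2 : ℚ⟦X⟧) * C (-1 / 2) = -1 := by
    rw [show (2 : ℚ⟦X⟧) = C 2 from (map_ofNat C 2).symm, ← map_mul]; norm_num
  rw [eisenstein_eight] at h0
  linear_combination 24 * h0 + 12 * eisenstein 2 * eisenstein 6 * h1 + 12 * eisenstein 4 ^ 2 * h2

end Ramanujan

/-! ### The Rankin–Cohen bracket as a polynomial in `E₂, E₄, E₆`. -/

section Bracket

open PowerSeries

theorem euler_ofNat (m : ℕ) [m.AtLeastTwo] : euler ℚ (ofNat(m) : ℚ⟦X⟧) = 0 :=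
  (euler ℚ).map_natCast m

/-- The operator `(24 X d/dX + c) ^ r`. -/
noncomputable def twist (c : ℚ) (r : ℕ) (f : ℚ⟦X⟧) : ℚ⟦X⟧ :=
  .mk fun n ↦ (24 * n + c) ^ r * coeff n f

theorem twist_zero (c : ℚ) (f : ℚ⟦X⟧) : twist c 0 f = f := by ext n; simp [twist]

theorem twist_succ (c : ℚ) (r : ℕ) (f : ℚ⟦X⟧) :
    twist c (r + 1) f = 24 * euler ℚ (twist c r f) + C c * twist c r f := by
  ext n
  rw [show (24 : ℚ⟦X⟧) = C 24 from (map_ofNat C 24).symm]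
  simp only [twist, map_add, coeff_C_mul, coeff_euler, coeff_mk]
  ring

/-- Iterates of `a ↦ 24 X a' + u a`, starting at `1`. -/
noncomputable def logIter (u : ℚ⟦X⟧) : ℕ → ℚ⟦X⟧
  | 0 => 1
  | r + 1 => 24 * euler ℚ (logIter u r) + u * logIter u r

/-- Conjugation by `f` turns `24 X d/dX + c` into `24 X d/dX + u`. -/
theorem twist_eq_mul_logIter {c : ℚ} {f u : ℚ⟦X⟧} (hf : 24 * euler ℚ f + C c * f = u * f) (r : ℕ) :
    twist c r f = f * logIter u r := by
  induction r with
  | zero => simp [twist_zero, logIter]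
  | succ r ih =>
    rw [twist_succ, ih, Derivation.leibniz, logIter]
    simp only [smul_eq_mul]
    linear_combination logIter u r * hf

/-- The shift `1 = 24 * (1/24)` accounts for the factor `q ^ (1/24)` of `η`. -/
theorem twist_pentagonalSeries (r : ℕ) :
    twist 1 r (pentagonalSeries ℚ) = pentagonalSeries ℚ * logIter (eisenstein 2) r := by
  apply twist_eq_mul_logIter
  rw [euler_pentagonalSeries, eisenstein_two, map_one]
  ring

theorem euler_partitionSeries :
    euler ℚ (partitionSeries ℚ) = partitionSeries ℚ * sigmaSeries ℚ := by
  have h := partitionSeries_mul_pentagonalSeries ℚ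
  have h' := congrArg (euler ℚ) h
  rw [Derivation.leibniz, euler_pentagonalSeries, Derivation.map_one_eq_zero] at h'
  simp only [smul_eq_mul] at h'
  linear_combination partitionSeries ℚ * h' +
    (partitionSeries ℚ * sigmaSeries ℚ - euler ℚ (partitionSeries ℚ)) * h

theorem twist_partitionSeries (r : ℕ) :
    twist (-1) r (partitionSeries ℚ) = partitionSeries ℚ * logIter (-eisenstein 2) r := by
  apply twist_eq_mul_logIter
  rw [euler_partitionSeries, eisenstein_two, map_neg, map_one]
  ring

/-- The integer coefficients of the Rankin–Cohen bracket of weights `1/2` and `-1/2`. -/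
def bracketCoeff (ν r : ℕ) : ℤ := (-1) ^ (ν + r) * (2 * ν - 2 * r - 1) * (2 * ν).choose (2 * r)

/-- The Rankin–Cohen bracket of `η` and `1 / η`. -/
noncomputable def bracket (ν : ℕ) : ℚ⟦X⟧ :=
  ∑ r ∈ Finset.range (ν + 1), (bracketCoeff ν r : ℚ⟦X⟧) *
    (twist 1 r (pentagonalSeries ℚ) * twist (-1) (ν - r) (partitionSeries ℚ))

theorem bracket_eq (ν : ℕ) : bracket ν = ∑ r ∈ Finset.range (ν + 1), (bracketCoeff ν r : ℚ⟦X⟧) *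
    (logIter (eisenstein 2) r * logIter (-eisenstein 2) (ν - r)) := by
  refine Finset.sum_congr rfl fun r _ ↦ ?_
  rw [twist_pentagonalSeries, twist_partitionSeries]
  linear_combination (bracketCoeff ν r : ℚ⟦X⟧) * logIter (eisenstein 2) r *
    logIter (-eisenstein 2) (ν - r) * partitionSeries_mul_pentagonalSeries ℚ

/-- Ramanujan's system of differential equations. -/
structure RamanujanSystem (P Q R : ℚ⟦X⟧) : Prop where
  euler_P : 24 * euler ℚ P = 2 * (P ^ 2 - Q)
  euler_Q : 24 * euler ℚ Q = 8 * (P * Q - R)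
  euler_R : 24 * euler ℚ R = 12 * (P * R - Q ^ 2)

theorem ramanujanSystem_eisenstein :
    RamanujanSystem (eisenstein 2) (eisenstein 4) (eisenstein 6) :=
  ⟨euler_eisenstein_two, euler_eisenstein_four, euler_eisenstein_six⟩

/-! ### Explicit iterates of `24 X d/dX ± P` for a solution of Ramanujan's system. -/

section Iterates

variable {P Q R : ℚ⟦X⟧}

set_option linter.unusedSimpArgs false

theorem logIter_eta_0 :
    logIter P 0 = 1 := rfl

theorem logIter_eta_1 :
    logIter P 1 = P := by
  rw [logIter, logIter_eta_0]
  simp only [map_add, map_sub, map_neg, Derivation.leibniz, Derivation.leibniz_pow, euler_ofNat,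
    Derivation.map_one_eq_zero, smul_eq_mul, nsmul_eq_mul, Nat.cast_ofNat, Nat.add_one_sub_one,
    Nat.reduceSub, pow_one, mul_zero, add_zero]
  ring

theorem logIter_eta_2 (h : RamanujanSystem P Q R) :
    logIter P 2 = 3 * P ^ 2 - 2 * Q := by
  rw [logIter, logIter_eta_1]
  linear_combination h.euler_P

theorem logIter_eta_3 (h : RamanujanSystem P Q R) :
    logIter P 3 = 15 * P ^ 3 - 30 * P * Q + 16 * R := by
  rw [logIter, logIter_eta_2 h]
  simp only [map_add, map_sub, map_neg, Derivation.leibniz, Derivation.leibniz_pow, euler_ofNat,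
    Derivation.map_one_eq_zero, smul_eq_mul, nsmul_eq_mul, Nat.cast_ofNat, Nat.add_one_sub_one,
    Nat.reduceSub, pow_one, mul_zero, add_zero]
  -- By the chain rule, the multipliers here and below are the partial derivatives of the previous
  -- iterate in `P`, `Q`, `R`.
  linear_combination (6 * P) * h.euler_P + (-2) * h.euler_Q

theorem logIter_eta_4 (h : RamanujanSystem P Q R) :
    logIter P 4 = 105 * P ^ 4 - 420 * P ^ 2 * Q + 448 * P * R - 132 * Q ^ 2 := by
  rw [logIter, logIter_eta_3 h]
  simp only [map_add, map_sub, map_neg, Derivation.leibniz, Derivation.leibniz_pow, euler_ofNat,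
    Derivation.map_one_eq_zero, smul_eq_mul, nsmul_eq_mul, Nat.cast_ofNat, Nat.add_one_sub_one,
    Nat.reduceSub, pow_one, mul_zero, add_zero]
  linear_combination (45 * P ^ 2 - 30 * Q) * h.euler_P + (-30 * P) * h.euler_Q + (16) * h.euler_R

theorem logIter_eta_5 (h : RamanujanSystem P Q R) :
    logIter P 5 = 945 * P ^ 5 - 6300 * P ^ 3 * Q + 10080 * P ^ 2 * R - 5940 * P * Q ^ 2 + 1216 *
      Q * R := by
  rw [logIter, logIter_eta_4 h]
  simp only [map_add, map_sub, map_neg, Derivation.leibniz, Derivation.leibniz_pow, euler_ofNat,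
    Derivation.map_one_eq_zero, smul_eq_mul, nsmul_eq_mul, Nat.cast_ofNat, Nat.add_one_sub_one,
    Nat.reduceSub, pow_one, mul_zero, add_zero]
  linear_combination (420 * P ^ 3 - 840 * P * Q + 448 * R) * h.euler_P + (-420 * P ^ 2 - 264 * Q)
    * h.euler_Q
    + (448 * P) * h.euler_R

theorem logIter_eta_6 (h : RamanujanSystem P Q R) :
    logIter P 6 = 10395 * P ^ 6 - 103950 * P ^ 4 * Q + 221760 * P ^ 3 * R - 196020 * P ^ 2 * Q ^
      2 + 80256 * P * Q * R - 2712 * Q ^ 3 - 9728 * R ^ 2 := by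
  rw [logIter, logIter_eta_5 h]
  simp only [map_add, map_sub, map_neg, Derivation.leibniz, Derivation.leibniz_pow, euler_ofNat,
    Derivation.map_one_eq_zero, smul_eq_mul, nsmul_eq_mul, Nat.cast_ofNat, Nat.add_one_sub_one,
    Nat.reduceSub, pow_one, mul_zero, add_zero]
  linear_combination (4725 * P ^ 4 - 18900 * P ^ 2 * Q + 20160 * P * R - 5940 * Q ^ 2) * h.euler_P +
    (-6300 * P ^ 3 - 11880 * P * Q + 1216 * R) * h.euler_Q + (10080 * P ^ 2 + 1216 * Q) * h.euler_R

theorem logIter_eta_7 (h : RamanujanSystem P Q R) :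
    logIter P 7 = 135135 * P ^ 7 - 1891890 * P ^ 5 * Q + 5045040 * P ^ 4 * R - 5945940 * P ^ 3 *
      Q ^ 2 + 3651648 * P ^ 2 * Q * R - 246792 * P * Q ^ 3 - 885248 * P * R ^ 2 + 138048 * Q ^ 2
      * R := by
  rw [logIter, logIter_eta_6 h]
  simp only [map_add, map_sub, map_neg, Derivation.leibniz, Derivation.leibniz_pow, euler_ofNat,
    Derivation.map_one_eq_zero, smul_eq_mul, nsmul_eq_mul, Nat.cast_ofNat, Nat.add_one_sub_one,
    Nat.reduceSub, pow_one, mul_zero, add_zero]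
  linear_combination (62370 * P ^ 5 - 415800 * P ^ 3 * Q + 665280 * P ^ 2 * R - 392040 * P * Q ^
    2 + 80256 * Q * R) * h.euler_P + (-103950 * P ^ 4 - 392040 * P ^ 2 * Q + 80256 * P * R - 8136
    * Q ^
    2) * h.euler_Q + (221760 * P ^ 3 + 80256 * P * Q - 19456 * R) * h.euler_R

theorem logIter_etaInv_0 :
    logIter (-P) 0 = 1 := rfl

theorem logIter_etaInv_1 :
    logIter (-P) 1 = -P := by
  rw [logIter, logIter_etaInv_0]
  simp only [map_add, map_sub, map_neg, Derivation.leibniz, Derivation.leibniz_pow, euler_ofNat,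
    Derivation.map_one_eq_zero, smul_eq_mul, nsmul_eq_mul, Nat.cast_ofNat, Nat.add_one_sub_one,
    Nat.reduceSub, pow_one, mul_zero, add_zero]
  ring

theorem logIter_etaInv_2 (h : RamanujanSystem P Q R) :
    logIter (-P) 2 = -P ^ 2 + 2 * Q := by
  rw [logIter, logIter_etaInv_1]
  simp only [map_add, map_sub, map_neg, Derivation.leibniz, Derivation.leibniz_pow, euler_ofNat,
    Derivation.map_one_eq_zero, smul_eq_mul, nsmul_eq_mul, Nat.cast_ofNat, Nat.add_one_sub_one,
    Nat.reduceSub, pow_one, mul_zero, add_zero]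
  linear_combination (-1) * h.euler_P

theorem logIter_etaInv_3 (h : RamanujanSystem P Q R) :
    logIter (-P) 3 = -3 * P ^ 3 + 18 * P * Q - 16 * R := by
  rw [logIter, logIter_etaInv_2 h]
  simp only [map_add, map_sub, map_neg, Derivation.leibniz, Derivation.leibniz_pow, euler_ofNat,
    Derivation.map_one_eq_zero, smul_eq_mul, nsmul_eq_mul, Nat.cast_ofNat, Nat.add_one_sub_one,
    Nat.reduceSub, pow_one, mul_zero, add_zero]
  linear_combination (-2 * P) * h.euler_P + (2) * h.euler_Q

theorem logIter_etaInv_4 (h : RamanujanSystem P Q R) :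
    logIter (-P) 4 = -15 * P ^ 4 + 180 * P ^ 2 * Q - 320 * P * R + 156 * Q ^ 2 := by
  rw [logIter, logIter_etaInv_3 h]
  simp only [map_add, map_sub, map_neg, Derivation.leibniz, Derivation.leibniz_pow, euler_ofNat,
    Derivation.map_one_eq_zero, smul_eq_mul, nsmul_eq_mul, Nat.cast_ofNat, Nat.add_one_sub_one,
    Nat.reduceSub, pow_one, mul_zero, add_zero]
  linear_combination (-9 * P ^ 2 + 18 * Q) * h.euler_P + (18 * P) * h.euler_Q + (-16) * h.euler_R

theorem logIter_etaInv_5 (h : RamanujanSystem P Q R) :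
    logIter (-P) 5 = -105 * P ^ 5 + 2100 * P ^ 3 * Q - 5600 * P ^ 2 * R + 5460 * P * Q ^ 2 -
      1856 * Q * R := by
  rw [logIter, logIter_etaInv_4 h]
  simp only [map_add, map_sub, map_neg, Derivation.leibniz, Derivation.leibniz_pow, euler_ofNat,
    Derivation.map_one_eq_zero, smul_eq_mul, nsmul_eq_mul, Nat.cast_ofNat, Nat.add_one_sub_one,
    Nat.reduceSub, pow_one, mul_zero, add_zero]
  linear_combination (-60 * P ^ 3 + 360 * P * Q - 320 * R) * h.euler_P + (180 * P ^ 2 + 312 * Q) *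
    h.euler_Q +
    (-320 * P) * h.euler_R

theorem logIter_etaInv_6 (h : RamanujanSystem P Q R) :
    logIter (-P) 6 = -945 * P ^ 6 + 28350 * P ^ 4 * Q - 100800 * P ^ 3 * R + 147420 * P ^ 2 * Q
      ^ 2 - 100224 * P * Q * R + 11352 * Q ^ 3 + 14848 * R ^ 2 := by
  rw [logIter, logIter_etaInv_5 h]
  simp only [map_add, map_sub, map_neg, Derivation.leibniz, Derivation.leibniz_pow, euler_ofNat,
    Derivation.map_one_eq_zero, smul_eq_mul, nsmul_eq_mul, Nat.cast_ofNat, Nat.add_one_sub_one,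
    Nat.reduceSub, pow_one, mul_zero, add_zero]
  linear_combination (-525 * P ^ 4 + 6300 * P ^ 2 * Q - 11200 * P * R + 5460 * Q ^ 2) * h.euler_P +
    (2100 * P ^ 3 + 10920 * P * Q - 1856 * R) * h.euler_Q + (-5600 * P ^ 2 - 1856 * Q) * h.euler_R

theorem logIter_etaInv_7 (h : RamanujanSystem P Q R) :
    logIter (-P) 7 = -10395 * P ^ 7 + 436590 * P ^ 5 * Q - 1940400 * P ^ 4 * R + 3783780 * P ^ 3
      * Q ^ 2 - 3858624 * P ^ 2 * Q * R + 874104 * P * Q ^ 3 + 1143296 * P * R ^ 2 - 428352 * Q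
      ^ 2 * R := by
  rw [logIter, logIter_etaInv_6 h]
  simp only [map_add, map_sub, map_neg, Derivation.leibniz, Derivation.leibniz_pow, euler_ofNat,
    Derivation.map_one_eq_zero, smul_eq_mul, nsmul_eq_mul, Nat.cast_ofNat, Nat.add_one_sub_one,
    Nat.reduceSub, pow_one, mul_zero, add_zero]
  linear_combination (-5670 * P ^ 5 + 113400 * P ^ 3 * Q - 302400 * P ^ 2 * R + 294840 * P * Q ^
    2 - 100224 * Q * R) * h.euler_P + (28350 * P ^ 4 + 294840 * P ^ 2 * Q - 100224 * P * R + 34056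
    * Q
    ^ 2) * h.euler_Q + (-100800 * P ^ 3 - 100224 * P * Q + 29696 * R) * h.euler_R

end Iterates

-- Every monomial containing `E₂` cancels, as modularity of the bracket predicts; likewise for the
-- other values of `ν`.
set_option linter.unusedSimpArgs false in
theorem bracket_two : bracket 2 = 8 * eisenstein 4 := by
  have h := ramanujanSystem_eisenstein
  rw [bracket_eq]
  simp only [Finset.sum_range_succ, Finset.sum_range_zero, Nat.reduceSub, Nat.reduceAdd,
    logIter_eta_0, logIter_eta_1, logIter_eta_2 h, logIter_etaInv_0, logIter_etaInv_1,
    logIter_etaInv_2 h]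
  simp only [show bracketCoeff 2 0 = 3 by decide, show bracketCoeff 2 1 = -6 by decide, show
    bracketCoeff 2 2 = -1 by decide]
  push_cast
  ring

set_option linter.unusedSimpArgs false in
theorem bracket_three : bracket 3 = 64 * eisenstein 6 := by
  have h := ramanujanSystem_eisenstein
  rw [bracket_eq]
  simp only [Finset.sum_range_succ, Finset.sum_range_zero, Nat.reduceSub, Nat.reduceAdd,
    logIter_eta_0, logIter_eta_1, logIter_eta_2 h, logIter_eta_3 h, logIter_etaInv_0,
    logIter_etaInv_1, logIter_etaInv_2 h,
    logIter_etaInv_3 h]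
  simp only [show bracketCoeff 3 0 = -5 by decide, show bracketCoeff 3 1 = 45 by decide, show
    bracketCoeff 3 2 = -15 by decide, show bracketCoeff 3 3 = -1 by decide]
  push_cast
  ring

set_option linter.unusedSimpArgs false in
theorem bracket_four : bracket 4 = 384 * eisenstein 8 := by
  have h := ramanujanSystem_eisenstein
  rw [bracket_eq, eisenstein_eight]
  simp only [Finset.sum_range_succ, Finset.sum_range_zero, Nat.reduceSub, Nat.reduceAdd,
    logIter_eta_0, logIter_eta_1, logIter_eta_2 h, logIter_eta_3 h, logIter_eta_4 h,
    logIter_etaInv_0, logIter_etaInv_1,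
    logIter_etaInv_2 h, logIter_etaInv_3 h, logIter_etaInv_4 h]
  simp only [show bracketCoeff 4 0 = 7 by decide, show bracketCoeff 4 1 = -140 by decide, show
    bracketCoeff 4 2 = 210 by decide, show bracketCoeff 4 3 = -28 by decide, show bracketCoeff 4
    4 = -1 by decide]
  push_cast
  ring

set_option linter.unusedSimpArgs false in
theorem bracket_five : bracket 5 = 2048 * eisenstein 10 := by
  have h := ramanujanSystem_eisenstein
  rw [bracket_eq, eisenstein_ten]
  simp only [Finset.sum_range_succ, Finset.sum_range_zero, Nat.reduceSub, Nat.reduceAdd,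
    logIter_eta_0, logIter_eta_1, logIter_eta_2 h, logIter_eta_3 h, logIter_eta_4 h, logIter_eta_5
    h, logIter_etaInv_0,
    logIter_etaInv_1, logIter_etaInv_2 h, logIter_etaInv_3 h,
    logIter_etaInv_4 h, logIter_etaInv_5 h]
  simp only [show bracketCoeff 5 0 = -9 by decide, show bracketCoeff 5 1 = 315 by decide, show
    bracketCoeff 5 2 = -1050 by decide, show bracketCoeff 5 3 = 630 by decide, show bracketCoeff
    5 4 = -45 by decide, show bracketCoeff 5 5 = -1 by decide]
  push_cast
  ring

set_option linter.unusedSimpArgs false in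
theorem bracket_seven : bracket 7 = 49152 * eisenstein 14 := by
  have h := ramanujanSystem_eisenstein
  rw [bracket_eq, eisenstein_fourteen]
  simp only [Finset.sum_range_succ, Finset.sum_range_zero, Nat.reduceSub, Nat.reduceAdd,
    logIter_eta_0, logIter_eta_1, logIter_eta_2 h, logIter_eta_3 h, logIter_eta_4 h, logIter_eta_5
    h, logIter_eta_6 h, logIter_eta_7 h, logIter_etaInv_0, logIter_etaInv_1, logIter_etaInv_2 h,
    logIter_etaInv_3 h, logIter_etaInv_4 h, logIter_etaInv_5 h,
    logIter_etaInv_6 h, logIter_etaInv_7 h]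
  simp only [show bracketCoeff 7 0 = -13 by decide, show bracketCoeff 7 1 = 1001 by decide, show
    bracketCoeff 7 2 = -9009 by decide, show bracketCoeff 7 3 = 21021 by decide, show
    bracketCoeff 7 4 = -15015 by decide, show bracketCoeff 7 5 = 3003 by decide, show
    bracketCoeff 7 6 = -91 by decide, show bracketCoeff 7 7 = -1 by decide]
  push_cast
  ring

end Bracket

/-! ### Coefficients of the bracket and the recurrence. -/

section Recurrence

open PowerSeries

/-- The integer factor of `g`. -/
def bracketPoly (ν : ℕ) (n k : ℤ) : ℤ :=
  ∑ r ∈ Finset.range (ν + 1), bracketCoeff ν r *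
    ((6 * k + 1) ^ (2 * r) * (24 * n - (6 * k + 1) ^ 2) ^ (ν - r))

/-- The rational factor of `g`. -/
def bracketScale (ν : ℕ) : ℚ :=
  (2 * (ν : ℚ) - 1) * fallingFactorial (2 * (ν : ℚ) - 2) ((ν : ℤ) - 1) ^ 2
      / (2 : ℚ) ^ (2 * (ν : ℤ) - 2) / (2 * ν).factorial

/-- Multiplication by `(2ν)!` turns the reciprocal factorials into binomial coefficients. -/
theorem g_eq (ν : ℕ) (n k : ℤ) : g ν n k = bracketScale ν * bracketPoly ν n k := by
  unfold g bracketScale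
  generalize (2 * (ν : ℚ) - 1) * fallingFactorial (2 * (ν : ℚ) - 2) ((ν : ℤ) - 1) ^ 2
      / (2 : ℚ) ^ (2 * (ν : ℤ) - 2) = A
  rw [div_mul_eq_mul_div, mul_div_assoc]
  congr 1
  rw [bracketPoly, Int.cast_sum, Finset.sum_div]
  refine Finset.sum_congr rfl fun r hr ↦ ?_
  have hr' : 2 * r ≤ 2 * ν := by have := Finset.mem_range.1 hr; omega
  have h0 : ((2 * ν).factorial : ℚ) ≠ 0 := by exact_mod_cast Nat.factorial_ne_zero _
  have h1 : ((2 * r).factorial : ℚ) ≠ 0 := by exact_mod_cast Nat.factorial_ne_zero _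
  have h2 : ((2 * ν - 2 * r).factorial : ℚ) ≠ 0 := by exact_mod_cast Nat.factorial_ne_zero _
  simp only [bracketCoeff]
  push_cast
  rw [Nat.cast_choose ℚ hr']
  field_simp

/-- Modulo `24 n - 1` only the term `r = ν` survives, and it equals `-1`; but `24 n - 1 ≥ 23` does
not divide `1`. -/
theorem bracketPoly_zero_ne_zero (ν : ℕ) {n : ℤ} (hn : 1 ≤ n) : bracketPoly ν n 0 ≠ 0 := by
  intro h
  have hd : 24 * n - 1 ∣ (1 : ℤ) := by
    have h1 : bracketPoly ν n 0 = (∑ r ∈ Finset.range ν, bracketCoeff ν r *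
        (24 * n - 1) ^ (ν - r)) - 1 := by
      rw [bracketPoly, Finset.sum_range_succ]
      simp [bracketCoeff, ← two_mul, sub_eq_add_neg]
    have h2 : 1 = ∑ r ∈ Finset.range ν, bracketCoeff ν r * (24 * n - 1) ^ (ν - r) := by linarith
    refine (Finset.dvd_sum fun r hr ↦ (dvd_pow_self _ ?_).mul_left _).trans h2.symm.dvd
    have := Finset.mem_range.1 hr
    omega
  have := Int.le_of_dvd one_pos hd
  omega

theorem omega_eq_pentagonal (k : ℤ) : omega k = pentagonal (-k) := by
  have h1 := two_mul_omega k
  have h2 := two_mul_natCast_pentagonal_neg k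
  linarith

theorem finite_omega_le (n : ℕ) : {k : ℤ | omega k ≤ n}.Finite := by
  have : {k : ℤ | omega k ≤ n} = (fun k ↦ pentagonal (-k)) ⁻¹' Set.Iic n := by
    ext k; simp [omega_eq_pentagonal]
  rw [this]
  exact (Set.finite_Iic n).preimage fun x _ y _ h ↦ by simpa using h

theorem p_eq_zero {n : ℕ} {k : ℤ} (h : ¬ omega k ≤ n) : p (n - omega k) = 0 := by
  rw [p, if_neg (by omega)]

theorem coeff_bracket (ν n : ℕ) : coeff n (bracket ν) = ∑ x ∈ Finset.HasAntidiagonal.antidiagonal n,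
    coeff x.1 (pentagonalSeries ℚ) * (Fintype.card x.2.Partition : ℚ) *
      ∑ r ∈ Finset.range (ν + 1), (bracketCoeff ν r : ℚ) *
        ((24 * x.1 + 1) ^ r * (24 * x.2 - 1) ^ (ν - r)) := by
  rw [bracket, map_sum]
  simp only [← map_intCast (C (R := ℚ)), coeff_C_mul]
  simp only [coeff_mul, Finset.mul_sum]
  rw [Finset.sum_comm]
  refine Finset.sum_congr rfl fun x _ ↦ Finset.sum_congr rfl fun r _ ↦ ?_
  simp only [twist, partitionSeries, coeff_mk]
  ring

/-- Only exponents `omega k` occur in `pentagonalSeries`, with sign `(-1) ^ k`, and `24 * omega k +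
1 = (6k + 1)²` turns the twist factors into those of `bracketPoly`. -/
theorem coeff_bracket_eq_sum (ν n : ℕ) : coeff n (bracket ν) =
    ∑ k ∈ (finite_omega_le n).toFinset, (-1 : ℚ) ^ k * bracketPoly ν n k * p (n - omega k) := by
  rw [coeff_bracket, Finset.Nat.sum_antidiagonal_eq_sum_range_succ_mk]
  symm
  refine Finset.sum_of_injOn (fun k ↦ pentagonal (-k)) (fun x _ y _ h ↦ by simpa using h) ?_ ?_ ?_
  · intro k hk
    have hk' : omega k ≤ n := by simpa using hk
    rw [omega_eq_pentagonal] at hk'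
    simp only [Finset.coe_range, Set.mem_Iio]
    omega
  · intro i hi hi'
    rw [coeff_pentagonalSeries_eq_zero, zero_mul, zero_mul]
    rintro ⟨k, rfl⟩
    refine hi' ⟨-k, ?_, by simp⟩
    have := Finset.mem_range.1 hi
    simp [omega_eq_pentagonal]
    omega
  · intro k hk
    have hk' : omega k ≤ n := by simpa using hk
    rw [omega_eq_pentagonal] at hk'
    have hle : pentagonal (-k) ≤ n := by exact_mod_cast hk'
    have h1 : p (n - omega k) = Fintype.card (n - pentagonal (-k)).Partition := by
      rw [p, omega_eq_pentagonal, if_pos (by omega)]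
      rw [show ((n : ℤ) - pentagonal (-k)).toNat = n - pentagonal (-k) by omega]
    have h2 : (24 * (pentagonal (-k) : ℚ) + 1) = (6 * k + 1) ^ 2 := by
      have : (2 * (pentagonal (-k) : ℤ) : ℚ) = k * (3 * k + 1) := by
        exact_mod_cast two_mul_natCast_pentagonal_neg k
      push_cast at this
      linear_combination 12 * this
    have h3 : (24 * ((n - pentagonal (-k) : ℕ) : ℚ) - 1) = 24 * n - (6 * k + 1) ^ 2 := by
      rw [Nat.cast_sub hle, ← h2]; ring
    simp only [h1, h2, h3, coeff_pentagonalSeries_pentagonal, Int.negOnePow_neg, Int.cast_negOnePow,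
      bracketPoly, ← pow_mul]
    push_cast
    ring

/-- The recurrence, for any `ν` whose bracket is a multiple of an Eisenstein series. -/
theorem recurrence {ν : ℕ} (c : ℚ) (hscale : bracketScale ν * c = (2 * ν - 2).choose (ν - 2))
    (hν : 2 ≤ ν) (hbracket : bracket ν = C c * eisenstein (2 * ν)) {n : ℕ} (hn : 1 ≤ n) :
    g ν n 0 ≠ 0 ∧
    {k : ℤ | p ((n : ℤ) - omega k) ≠ 0}.Finite ∧
    (p (n : ℤ) : ℚ) = 1 / g ν n 0 *
      (-(4 * (ν : ℚ) / bernoulli (2 * ν)) * ((2 * ν - 2).choose (ν - 2) : ℚ)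
          * (ArithmeticFunction.sigma (2 * ν - 1) n : ℚ)
        + ∑ᶠ (k : ℤ) (_ : k ≠ 0), (-1 : ℚ) ^ (k + 1) * g ν n k * (p ((n : ℤ) - omega k) : ℚ)) := by
  have hs : bracketScale ν ≠ 0 := by
    intro h
    rw [h, zero_mul] at hscale
    exact (Nat.choose_pos (by omega : ν - 2 ≤ 2 * ν - 2)).ne (by exact_mod_cast hscale)
  have hg : g ν n 0 ≠ 0 := by
    rw [g_eq]
    exact mul_ne_zero hs (by exact_mod_cast bracketPoly_zero_ne_zero ν (by exact_mod_cast hn))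
  refine ⟨hg, (finite_omega_le n).subset fun k hk ↦ ?_, ?_⟩
  · by_contra h
    exact hk (p_eq_zero h)
  have hfin : ∑ᶠ (k : ℤ) (_ : k ≠ 0), (-1 : ℚ) ^ (k + 1) * g ν n k * (p ((n : ℤ) - omega k) : ℚ) =
      ∑ k ∈ (finite_omega_le n).toFinset, if k ≠ 0 then
        (-1 : ℚ) ^ (k + 1) * g ν n k * (p ((n : ℤ) - omega k) : ℚ) else 0 := by
    simp only [finsum_eq_if]
    refine finsum_eq_sum_of_support_subset _ fun k hk ↦ ?_
    by_contra h
    have h' : ¬ omega k ≤ n := by simpa using h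
    exact hk (by simp [p_eq_zero h'])
  have h0 : (0 : ℤ) ∈ (finite_omega_le n).toFinset := by simp [omega]
  -- The term `k = 0` contains `p n`; moving the others across changes their sign to `(-1) ^ (k +
  -- 1)`.
  have hsum : bracketScale ν * coeff n (bracket ν) = g ν n 0 * p n -
      ∑ k ∈ (finite_omega_le n).toFinset, if k ≠ 0 then
        (-1 : ℚ) ^ (k + 1) * g ν n k * (p ((n : ℤ) - omega k) : ℚ) else 0 := by
    have h1 : g ν n 0 * p n = ∑ k ∈ (finite_omega_le n).toFinset,
        if k = 0 then g ν n 0 * (p n : ℚ) else 0 := by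
      rw [Finset.sum_ite_eq' _ _ (fun _ ↦ g ν n 0 * (p n : ℚ)), if_pos h0]
    rw [coeff_bracket_eq_sum, h1, ← Finset.sum_sub_distrib, Finset.mul_sum]
    refine Finset.sum_congr rfl fun k _ ↦ ?_
    rw [zpow_add₀ (by norm_num : (-1 : ℚ) ≠ 0)]
    rcases eq_or_ne k 0 with rfl | hk
    · simp [g_eq, omega]
      ring
    · simp [hk, g_eq]
      ring
  rw [hfin, eq_comm, one_div, inv_mul_eq_iff_eq_mul₀ hg]
  rw [hbracket, coeff_C_mul, ← mul_assoc, hscale, eisenstein, coeff_mk, if_neg (by omega)] at hsum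
  push_cast at hsum
  linear_combination hsum

end Recurrence

end PentagonalRecurrence

theorem corollary1p2 (ν : ℕ) (hν : ν ∈ ({2, 3, 4, 5, 7} : Set ℕ)) (n : ℕ) (hn : 1 ≤ n) :
    PentagonalRecurrence.g ν n 0 ≠ 0 ∧
    {k : ℤ | PentagonalRecurrence.p ((n : ℤ) - PentagonalRecurrence.omega k) ≠ 0}.Finite ∧
    (PentagonalRecurrence.p (n : ℤ) : ℚ) =
      1 / PentagonalRecurrence.g ν n 0 *
        (-(4 * (ν : ℚ) / bernoulli (2 * ν)) * ((2 * ν - 2).choose (ν - 2) : ℚ)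
            * (ArithmeticFunction.sigma (2 * ν - 1) n : ℚ)
          + ∑ᶠ (k : ℤ) (_ : k ≠ 0),
              (-1 : ℚ) ^ (k + 1) * PentagonalRecurrence.g ν n k
                * (PentagonalRecurrence.p ((n : ℤ) - PentagonalRecurrence.omega k) : ℚ)) := by
  have hscale (m : ℕ) (x : ℚ) : PentagonalRecurrence.fallingFactorial x (m : ℤ) =
      ∏ i ∈ Finset.range m, (x - i) := rfl
  have hpow (m : ℕ) : (2 : ℚ) ^ (m : ℤ) = 2 ^ m := zpow_natCast _ _
  rcases hν with rfl | rfl | rfl | rfl | rfl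
  -- In each case the constant is the constant term of the bracket, `∑ r, (2ν - 2r - 1) *
  -- (2ν).choose (2r) = 2 ^ (2ν - 1) * (ν - 1)`.
  · refine PentagonalRecurrence.recurrence 8 ?_ le_rfl
      (by rw [PentagonalRecurrence.bracket_two, map_ofNat]) hn
    rw [PentagonalRecurrence.bracketScale, show ((2 : ℕ) : ℤ) - 1 = (1 : ℕ) from rfl, hscale,
      show 2 * ((2 : ℕ) : ℤ) - 2 = (2 : ℕ) from rfl, hpow]
    norm_num [Finset.prod_range_succ, Nat.factorial, Nat.choose]
  · refine PentagonalRecurrence.recurrence 64 ?_ (by norm_num)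
      (by rw [PentagonalRecurrence.bracket_three, map_ofNat]) hn
    rw [PentagonalRecurrence.bracketScale, show ((3 : ℕ) : ℤ) - 1 = (2 : ℕ) from rfl, hscale,
      show 2 * ((3 : ℕ) : ℤ) - 2 = (4 : ℕ) from rfl, hpow]
    norm_num [Finset.prod_range_succ, Nat.factorial, Nat.choose]
  · refine PentagonalRecurrence.recurrence 384 ?_ (by norm_num)
      (by rw [PentagonalRecurrence.bracket_four, map_ofNat]) hn
    rw [PentagonalRecurrence.bracketScale, show ((4 : ℕ) : ℤ) - 1 = (3 : ℕ) from rfl, hscale,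
      show 2 * ((4 : ℕ) : ℤ) - 2 = (6 : ℕ) from rfl, hpow]
    norm_num [Finset.prod_range_succ, Nat.factorial, Nat.choose]
  · refine PentagonalRecurrence.recurrence 2048 ?_ (by norm_num)
      (by rw [PentagonalRecurrence.bracket_five, map_ofNat]) hn
    rw [PentagonalRecurrence.bracketScale, show ((5 : ℕ) : ℤ) - 1 = (4 : ℕ) from rfl, hscale,
      show 2 * ((5 : ℕ) : ℤ) - 2 = (8 : ℕ) from rfl, hpow]
    norm_num [Finset.prod_range_succ, Nat.factorial, Nat.choose]
  · refine PentagonalRecurrence.recurrence 49152 ?_ (by norm_num)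
      (by rw [PentagonalRecurrence.bracket_seven, map_ofNat]) hn
    rw [PentagonalRecurrence.bracketScale, show ((7 : ℕ) : ℤ) - 1 = (6 : ℕ) from rfl, hscale,
      show 2 * ((7 : ℕ) : ℤ) - 2 = (12 : ℕ) from rfl, hpow]
    norm_num [Finset.prod_range_succ, Nat.factorial, Nat.choose]
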